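/- Let $d,k\ge 0$ be integers with $d\ge 2k+1$, and let $\mathbb K=\mathbb R$ or $\mathbb K=\mathbb C$; put $r_{\mathbb R}=1$ and $r_{\mathbb C}=2$. For $0\le j\le d$ let $\mathrm{Gr}_j(\mathbb K^d)$ be the Grassmannian of $j$-dimensional $\mathbb K$-linear subspaces of $\mathbb K^d$, with its usual topology. Call a set $\Lambda\subset \mathrm{Gr}_k(\mathbb K^d)\times\mathrm{Gr}_{d-k}(\mathbb K^d)$ transverse if $V\subset W$ for every $(V,W)\in\Lambda$, and $V\oplus W'=\mathbb K^d$ for any two distinct elements $(V,W),(V',W')\in\Lambda$. Then there is no transverse set $\Lambda\subset \mathrm{Gr}_k(\mathbb K^d)\times\mathrm{Gr}_{d-k}(\mathbb K^d)$ that properly contains a topological sphere of dimension $r_{\mathbb K}(d-k)-1$, that is, a proper subset $S\subsetneq\Lambda$ which, with the subspace topology, is homeomorphic to the unit sphere of $\mathbb R^{r_{\mathbb K}(d-k)}$. -/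

import Mathlib

/-- The Grassmannian `Gr_k(𝕜ᵈ)`: the set of `k`-dimensional `𝕜`-linear subspaces of `𝕜ᵈ`.
The standard (Hermitian) inner product of `𝕜ᵈ` is only used to describe the topology. -/
def Gr (𝕜 : Type) [RCLike 𝕜] (d k : ℕ) : Type :=
  {V : Submodule 𝕜 (EuclideanSpace 𝕜 (Fin d)) // Module.finrank 𝕜 V = k}

/-- The subspace of `𝕜ᵈ` underlying a point of the Grassmannian. -/
def Gr.space {𝕜 : Type} [RCLike 𝕜] {d k : ℕ} (V : Gr 𝕜 d k) :
    Submodule 𝕜 (EuclideanSpace 𝕜 (Fin d)) :=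
  V.1

/-- The usual topology of `Gr_k(𝕜ᵈ)`, given by the embedding that sends a subspace to the
orthogonal projection of `𝕜ᵈ` onto it, in the (finite-dimensional) normed space of operators. -/
noncomputable instance Gr.instTopologicalSpace (𝕜 : Type) [RCLike 𝕜] (d k : ℕ) :
    TopologicalSpace (Gr 𝕜 d k) :=
  TopologicalSpace.induced
    (fun V : Gr 𝕜 d k =>
      (V.space.starProjection : EuclideanSpace 𝕜 (Fin d) →L[𝕜] EuclideanSpace 𝕜 (Fin d)))
    inferInstance

/-- A set of pairs `(V, W)` in `Gr_k(𝕜ᵈ) × Gr_{d-k}(𝕜ᵈ)` is transverse if it consists of partial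
flags, `V ⊆ W`, and any two distinct members `(V, W)` and `(V', W')` satisfy `V ⊕ W' = 𝕜ᵈ`
(and `V' ⊕ W = 𝕜ᵈ`, by symmetry). -/
def IsTransverseSet {𝕜 : Type} [RCLike 𝕜] {d k : ℕ}
    (Λ : Set (Gr 𝕜 d k × Gr 𝕜 d (d - k))) : Prop :=
  (∀ x ∈ Λ, x.1.space ≤ x.2.space) ∧
    ∀ x ∈ Λ, ∀ y ∈ Λ, x ≠ y → IsCompl x.1.space y.2.space

/-- A subset of a topological space is a topological `n`-sphere if it is homeomorphic, in the
subspace topology, to the unit sphere of `ℝⁿ⁺¹`. -/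
def IsTopologicalSphere {X : Type} [TopologicalSpace X] (n : ℕ) (S : Set X) : Prop :=
  Nonempty (S ≃ₜ Metric.sphere (0 : EuclideanSpace ℝ (Fin (n + 1))) 1)

/-!
The theorem is reduced to the Borsuk–Ulam theorem, which is proved here by a cochain argument on
a triangulated sphere.

*Reduction.* Suppose that `(V₀, W₀)` is transverse to every pair `(V x, W x)` of a transverse
sphere, parametrised by the unit sphere `X` of a real vector space with the real dimension of `W₀`.
Fix a vector `u` outside `W₀`. As `V x` is a complement of `W₀`, it contains a unique `p x` in
`u + W₀`; as `V₀` is a complement of `W y`, the vector `p x` has a projection `g x y` to `V₀` along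
`W y`, and `g x y ≠ 0` for `x ≠ y` because `V x ∩ W y = 0`. Let `a x` be the class of
`p x - p (-x)` in `W₀ / V₀` and put `b x = g x (-x)`. Then `a` is odd, and where `a` vanishes
`b x = p x - p (-x)` is odd too. So the segment from `(a x, b x)` to `(a x, -b (-x))` avoids zero:
it is a homotopy through maps into `W₀ / V₀ × V₀ ∖ {0}` that reverses its direction under the
antipodal map. At its ends the second component has no zeros, so there the map contracts to a
constant in the nonzero factor `W₀ / V₀`, whose dimension is `d - 2k > 0`. Together this is an odd
map without zeros from a sphere of dimension `dim W₀` to `W₀`, which Borsuk–Ulam forbids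
(`false_of_odd_of_ne_zero`, `false_of_transverse_sphere`).

*Borsuk–Ulam.* The boundary of the cube `[-m, m]ⁿ⁺¹` is triangulated by iterated prism operators,
which gives chains `cap m j` modulo two, half spheres with
`∂ (cap (j + 1)) = cap j + ν (cap j)` for the antipodal map `ν`. For antipodal sign functions
`σ 0, σ 1, …` with values in `ZMod 2`, the cup product `δσ (j - 1) ∪ ⋯ ∪ δσ 0` has the value `1`
on `cap m j`, by induction on `j`: it is the coboundary of
`X = σ (j - 1) ∪ δσ (j - 2) ∪ ⋯ ∪ δσ 0`, and `X + X ∘ ν` is the cup product one degree lower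
(`WordChain.eval_signChanges_cap`). When the `σ i` are the signs of the components of an odd map to
`ℝⁿ`, this provides a small simplex on which every component changes sign, so that the map is small
there (`exists_zero_of_odd`).
-/

/-! ### Chains of words with coefficients modulo two -/

/-- Chains modulo two whose simplices are words of vertices: a word `[v₀, …, vⱼ]` stands for an
ordered `j`-simplex, possibly degenerate, and the empty word for the augmentation. -/
abbrev WordChain (V : Type) : Type := List V →₀ ZMod 2

namespace WordChain

variable {V : Type}

/-- The cone operator `w ↦ v :: w`. -/
noncomputable def cons (v : V) : WordChain V →ₗ[ZMod 2] WordChain V :=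
  Finsupp.lmapDomain (ZMod 2) (ZMod 2) (List.cons v)

/-- The map of chains induced by a map of vertices. -/
noncomputable def map (f : V → V) : WordChain V →ₗ[ZMod 2] WordChain V :=
  Finsupp.lmapDomain (ZMod 2) (ZMod 2) (List.map f)

/-- The boundary of a word: the sum of the words obtained by omitting one letter. -/
noncomputable def wordBoundary : List V → WordChain V
  | [] => 0
  | v :: w => Finsupp.single w 1 + cons v (wordBoundary w)

/-- The boundary operator on chains. -/
noncomputable def boundary : WordChain V →ₗ[ZMod 2] WordChain V :=
  Finsupp.linearCombination (ZMod 2) wordBoundary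

/-- The triangulated prism over a word, whose bottom is moved by `s` and whose top by `t`. -/
noncomputable def wordPrism (s t : V → V) : List V → WordChain V
  | [] => 0
  | v :: w => Finsupp.single (s v :: t v :: w.map t) 1 + cons (s v) (wordPrism s t w)

/-- The prism operator, a chain homotopy between `map s` and `map t`. -/
noncomputable def prism (s t : V → V) : WordChain V →ₗ[ZMod 2] WordChain V :=
  Finsupp.linearCombination (ZMod 2) (wordPrism s t)

@[simp] lemma cons_single (v : V) (w : List V) (c : ZMod 2) :
    cons v (Finsupp.single w c) = Finsupp.single (v :: w) c := by
  simp [cons, Finsupp.mapDomain_single]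

@[simp] lemma map_single (f : V → V) (w : List V) (c : ZMod 2) :
    map f (Finsupp.single w c) = Finsupp.single (w.map f) c := by
  simp [map, Finsupp.mapDomain_single]

@[simp] lemma boundary_single (w : List V) :
    boundary (Finsupp.single w (1 : ZMod 2)) = wordBoundary w := by
  simp [boundary]

@[simp] lemma prism_single (s t : V → V) (w : List V) :
    prism s t (Finsupp.single w (1 : ZMod 2)) = wordPrism s t w := by
  simp [prism]

/-- Two linear maps on chains agree if they agree on words. -/
lemma hom_ext {M : Type} [AddCommMonoid M] [Module (ZMod 2) M]
    {f g : WordChain V →ₗ[ZMod 2] M}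
    (h : ∀ w, f (Finsupp.single w 1) = g (Finsupp.single w 1)) : f = g :=
  Finsupp.lhom_ext' fun w => LinearMap.ext_ring (h w)

lemma boundary_cons (v : V) (x : WordChain V) :
    boundary (cons v x) = x + cons v (boundary x) := by
  have : boundary ∘ₗ cons v = LinearMap.id + cons v ∘ₗ boundary :=
    hom_ext fun w => by simp [wordBoundary]
  exact LinearMap.congr_fun this x

lemma prism_cons (s t : V → V) (v : V) (x : WordChain V) :
    prism s t (cons v x) = cons (s v) (cons (t v) (map t x)) + cons (s v) (prism s t x) := by
  have : prism s t ∘ₗ cons v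
      = cons (s v) ∘ₗ cons (t v) ∘ₗ map t + cons (s v) ∘ₗ prism s t :=
    hom_ext fun w => by simp [wordPrism]
  exact LinearMap.congr_fun this x

lemma map_cons (f : V → V) (v : V) (x : WordChain V) :
    map f (cons v x) = cons (f v) (map f x) := by
  have : map f ∘ₗ cons v = cons (f v) ∘ₗ map f := hom_ext fun w => by simp
  exact LinearMap.congr_fun this x

lemma map_map (f g : V → V) (x : WordChain V) : map f (map g x) = map (f ∘ g) x := by
  have : map f ∘ₗ map g = map (f ∘ g) := hom_ext fun w => by simp
  exact LinearMap.congr_fun this x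

/-- Identities of chains may be checked on words, one letter at a time. -/
lemma hom_ext_cons {f g : WordChain V →ₗ[ZMod 2] WordChain V}
    (h0 : f (Finsupp.single [] 1) = g (Finsupp.single [] 1))
    (h : ∀ v w, f (Finsupp.single w 1) = g (Finsupp.single w 1) →
      f (cons v (Finsupp.single w 1)) = g (cons v (Finsupp.single w 1))) : f = g :=
  hom_ext fun w => by
    induction w with
    | nil => exact h0
    | cons v w ih => simpa using h v w ih

lemma boundary_map (f : V → V) (x : WordChain V) :
    boundary (map f x) = map f (boundary x) := by
  have : boundary ∘ₗ map f = map f ∘ₗ boundary := by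
    refine hom_ext_cons (by simp [wordBoundary]) fun v w ih => ?_
    simp only [LinearMap.comp_apply] at ih ⊢
    rw [map_cons, boundary_cons, boundary_cons, map_add, map_cons, ih]
  exact LinearMap.congr_fun this x

lemma boundary_boundary (x : WordChain V) : boundary (boundary x) = 0 := by
  have : boundary ∘ₗ boundary = (0 : WordChain V →ₗ[ZMod 2] WordChain V) := by
    refine hom_ext_cons (by simp [wordBoundary]) fun v w ih => ?_
    simp only [LinearMap.comp_apply, LinearMap.zero_apply] at ih ⊢
    rw [boundary_cons, map_add, boundary_cons, ih, map_zero, add_zero, ZModModule.add_self]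
  exact LinearMap.congr_fun this x

/-- The prism operator is a chain homotopy. -/
lemma boundary_prism (s t : V → V) (x : WordChain V) :
    boundary (prism s t x) = map s x + map t x + prism s t (boundary x) := by
  have : boundary ∘ₗ prism s t = map s + map t + prism s t ∘ₗ boundary := by
    refine hom_ext_cons ?_ fun v w ih => ?_
    · simp [wordBoundary, wordPrism, ZModModule.add_self]
    simp only [LinearMap.comp_apply, LinearMap.add_apply] at ih ⊢
    set x : WordChain V := Finsupp.single w 1
    rw [prism_cons, map_add, boundary_cons, boundary_cons, boundary_cons, boundary_cons, ih,
      boundary_map, map_cons, map_cons]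
    simp only [map_add, prism_cons]
    have h2 (y : WordChain V) : -y = y := ZModModule.neg_eq_self y
    rw [← sub_eq_zero]
    simp only [sub_eq_add_neg, h2]
    have e (a b c d e f : WordChain V) :
      a + (b + c) + (d + (e + b + f)) + (e + a + (d + (c + f)))
        = (a + a) + (b + b) + (c + c) + (d + d) + (e + e) + (f + f) := by abel
    rw [e]
    simp [ZModModule.add_self]
  exact LinearMap.congr_fun this x

/-! ### Chains carried by a relation -/

/-- Chains all of whose words have pairwise related letters (every letter also to itself). -/
noncomputable def carried (R : V → V → Prop) : Submodule (ZMod 2) (WordChain V) :=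
  Finsupp.supported (ZMod 2) (ZMod 2) {w | ∀ u ∈ w, ∀ v ∈ w, R u v}

lemma single_mem_carried {R : V → V → Prop} {w : List V} (h : ∀ u ∈ w, ∀ v ∈ w, R u v) :
    (Finsupp.single w 1 : WordChain V) ∈ carried R :=
  Finsupp.single_mem_supported _ _ h

/-- A linear map respects carriers as soon as it does so on words. -/
lemma linearCombination_mem_carried {R R' : V → V → Prop} {f : List V → WordChain V}
    (h : ∀ w, (∀ u ∈ w, ∀ v ∈ w, R u v) → f w ∈ carried R') {x : WordChain V}
    (hx : x ∈ carried R) : Finsupp.linearCombination (ZMod 2) f x ∈ carried R' := by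
  rw [Finsupp.linearCombination_apply]
  exact Submodule.sum_mem _ fun w hw =>
    Submodule.smul_mem _ _ (h w ((Finsupp.mem_supported _ _).1 hx hw))

lemma cons_mem_supported (v : V) {S T : Set (List V)} (h : ∀ w ∈ S, v :: w ∈ T)
    {x : WordChain V} (hx : x ∈ Finsupp.supported (ZMod 2) (ZMod 2) S) :
    cons v x ∈ Finsupp.supported (ZMod 2) (ZMod 2) T := by
  have := Finsupp.lmapDomain_supported (R := ZMod 2) (M := ZMod 2) (List.cons v) S
  have h2 : cons v x ∈ Finsupp.supported (ZMod 2) (ZMod 2) (List.cons v '' S) := by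
    rw [← this]; exact Submodule.mem_map_of_mem hx
  exact Finsupp.supported_mono (by rintro _ ⟨w, hw, rfl⟩; exact h w hw) h2

lemma wordBoundary_mem (w : List V) :
    wordBoundary w ∈ Finsupp.supported (ZMod 2) (ZMod 2) {w' | ∀ u ∈ w', u ∈ w} := by
  induction w with
  | nil => exact Submodule.zero_mem _
  | cons v w ih =>
    refine Submodule.add_mem _ (Finsupp.single_mem_supported _ _ ?_)
      (cons_mem_supported v ?_ ih)
    · intro u hu; exact List.mem_cons_of_mem v hu
    · intro w' hw' u hu
      rcases List.mem_cons.1 hu with rfl | hu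
      · exact List.mem_cons_self
      · exact List.mem_cons_of_mem v (hw' u hu)

lemma wordPrism_mem (s t : V → V) (w : List V) :
    wordPrism s t w ∈
      Finsupp.supported (ZMod 2) (ZMod 2) {w' | ∀ u ∈ w', ∃ v ∈ w, u = s v ∨ u = t v} := by
  induction w with
  | nil => exact Submodule.zero_mem _
  | cons v w ih =>
    refine Submodule.add_mem _ (Finsupp.single_mem_supported _ _ ?_)
      (cons_mem_supported (s v) ?_ ih)
    · intro u hu
      simp only [List.mem_cons, List.mem_map] at hu
      rcases hu with rfl | rfl | ⟨v', hv', rfl⟩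
      · exact ⟨v, by simp, Or.inl rfl⟩
      · exact ⟨v, by simp, Or.inr rfl⟩
      · exact ⟨v', by simp [hv'], Or.inr rfl⟩
    · intro w' hw' u hu
      rcases List.mem_cons.1 hu with rfl | hu
      · exact ⟨v, by simp, Or.inl rfl⟩
      · obtain ⟨v', hv', h⟩ := hw' u hu
        exact ⟨v', by simp [hv'], h⟩

lemma boundary_mem_carried {R : V → V → Prop} {x : WordChain V} (hx : x ∈ carried R) :
    boundary x ∈ carried R :=
  linearCombination_mem_carried (fun w hw => Finsupp.supported_mono
    (fun _ (hw' : ∀ u ∈ _, u ∈ w) u hu v hv => hw u (hw' u hu) v (hw' v hv))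
    (wordBoundary_mem w)) hx

lemma prism_mem_carried {R R' : V → V → Prop} {s t : V → V}
    (h : ∀ u v, R u v → R' (s u) (s v) ∧ R' (s u) (t v) ∧ R' (t u) (s v) ∧ R' (t u) (t v))
    {x : WordChain V} (hx : x ∈ carried R) : prism s t x ∈ carried R' := by
  refine linearCombination_mem_carried (fun w hw => Finsupp.supported_mono ?_
    (wordPrism_mem s t w)) hx
  intro w' hw' u hu v hv
  obtain ⟨u', hu', rfl | rfl⟩ := hw' u hu <;> obtain ⟨v', hv', rfl | rfl⟩ := hw' v hv
  · exact (h _ _ (hw u' hu' v' hv')).1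
  · exact (h _ _ (hw u' hu' v' hv')).2.1
  · exact (h _ _ (hw u' hu' v' hv')).2.2.1
  · exact (h _ _ (hw u' hu' v' hv')).2.2.2

lemma map_mem_carried {R R' : V → V → Prop} {f : V → V}
    (h : ∀ u v, R u v → R' (f u) (f v)) {x : WordChain V} (hx : x ∈ carried R) :
    map f x ∈ carried R' := by
  have e : map f = Finsupp.linearCombination (ZMod 2)
      (fun w : List V => (Finsupp.single (w.map f) 1 : WordChain V)) :=
    hom_ext fun w => by simp
  rw [e]
  refine linearCombination_mem_carried (fun w hw => single_mem_carried ?_) hx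
  intro u hu v hv
  obtain ⟨u', hu', rfl⟩ := List.mem_map.1 hu
  obtain ⟨v', hv', rfl⟩ := List.mem_map.1 hv
  exact h _ _ (hw u' hu' v' hv')

/-! ### The cochain counting sign changes -/

/-- The indicator of the words `[v₀, …, vⱼ]` for which `σ (j - 1 - i)` changes between `vᵢ` and
`vᵢ₊₁`, for every `i < j`: the cup product of the coboundaries of `σ (j - 1), …, σ 0`. -/
def signChanges (σ : ℕ → V → ZMod 2) : ℕ → List V → ZMod 2
  | 0, [_] => 1
  | j + 1, u :: v :: w => (σ j u + σ j v) * signChanges σ j (v :: w)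
  | _, _ => 0

/-- The cup product of the `0`-cochain `σ j` with `signChanges σ j`; it is the cochain whose
coboundary is `signChanges σ (j + 1)`. -/
def signPrimitive (σ : ℕ → V → ZMod 2) (j : ℕ) : List V → ZMod 2
  | [] => 0
  | v :: w => σ j v * signChanges σ j (v :: w)

/-- Evaluation of a cochain on chains. -/
noncomputable def eval (φ : List V → ZMod 2) : WordChain V →ₗ[ZMod 2] ZMod 2 :=
  Finsupp.linearCombination (ZMod 2) φ

@[simp] lemma eval_single (φ : List V → ZMod 2) (w : List V) :
    eval φ (Finsupp.single w (1 : ZMod 2)) = φ w := by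
  simp [eval]

lemma eval_signPrimitive_cons (σ : ℕ → V → ZMod 2) (j : ℕ) (v : V) (x : WordChain V) :
    eval (signPrimitive σ j) (cons v x) = σ j v * eval (signChanges σ j) (cons v x) := by
  have : eval (signPrimitive σ j) ∘ₗ cons v = σ j v • (eval (signChanges σ j) ∘ₗ cons v) :=
    hom_ext fun w => by simp [signPrimitive]
  exact LinearMap.congr_fun this x

lemma signChanges_nil (σ : ℕ → V → ZMod 2) (j : ℕ) : signChanges σ j [] = 0 := by
  cases j <;> rfl

lemma signChanges_succ_singleton (σ : ℕ → V → ZMod 2) (j : ℕ) (v : V) :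
    signChanges σ (j + 1) [v] = 0 := rfl

/-- `signChanges` is the coboundary of `signPrimitive`, given that it is a cocycle one degree
lower. -/
lemma eval_signPrimitive_boundary_of_cocycle (σ : ℕ → V → ZMod 2) (j : ℕ)
    (h : ∀ x : WordChain V, eval (signChanges σ j) (boundary x) = 0) (x : WordChain V) :
    eval (signPrimitive σ j) (boundary x) = eval (signChanges σ (j + 1)) x := by
  have : eval (signPrimitive σ j) ∘ₗ boundary = eval (signChanges σ (j + 1)) := by
    refine hom_ext fun w => ?_
    rcases w with _ | ⟨u, w⟩
    · simp [wordBoundary, signChanges_nil]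
    have h1 := h (cons u (Finsupp.single w 1))
    rw [boundary_cons, map_add, CharTwo.add_eq_zero] at h1
    rw [LinearMap.comp_apply, ← cons_single, boundary_cons, map_add, eval_signPrimitive_cons,
      ← h1]
    rcases w with _ | ⟨v, w⟩
    · simp [signPrimitive, signChanges_nil, signChanges_succ_singleton]
    · simp only [cons_single, eval_single, signPrimitive, signChanges]
      ring
  exact LinearMap.congr_fun this x

lemma eval_signChanges_boundary (σ : ℕ → V → ZMod 2) (j : ℕ) :
    ∀ x : WordChain V, eval (signChanges σ j) (boundary x) = 0 := by
  induction j with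
  | zero =>
    have h2 (u v : V) (x : WordChain V) : eval (signChanges σ 0) (cons u (cons v x)) = 0 := by
      have : eval (signChanges σ 0) ∘ₗ cons u ∘ₗ cons v = 0 :=
        hom_ext fun w => by simp [signChanges]
      exact LinearMap.congr_fun this x
    have : eval (signChanges σ 0) ∘ₗ boundary = 0 := by
      refine hom_ext fun w => ?_
      rcases w with _ | ⟨u, _ | ⟨v, w⟩⟩
      · simp [wordBoundary]
      · simp [wordBoundary, signChanges_nil]
      · simp only [LinearMap.comp_apply, boundary_single, wordBoundary, map_add, h2, cons_single,
          eval_single, LinearMap.zero_apply]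
        rcases w with _ | ⟨_, _⟩ <;> simp [signChanges, CharTwo.add_self_eq_zero]
    exact fun x => LinearMap.congr_fun this x
  | succ j ih =>
    intro x
    rw [← eval_signPrimitive_boundary_of_cocycle σ j ih, boundary_boundary, map_zero]

lemma eval_signPrimitive_boundary (σ : ℕ → V → ZMod 2) (j : ℕ) (x : WordChain V) :
    eval (signPrimitive σ j) (boundary x) = eval (signChanges σ (j + 1)) x :=
  eval_signPrimitive_boundary_of_cocycle σ j (eval_signChanges_boundary σ j) x

lemma eq_zero_of_carried {φ : List V → ZMod 2} {R : V → V → Prop}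
    (h : ∀ w, (∀ u ∈ w, ∀ v ∈ w, R u v) → φ w = 0) {x : WordChain V} (hx : x ∈ carried R) :
    eval φ x = 0 := by
  rw [eval, Finsupp.linearCombination_apply]
  exact Finset.sum_eq_zero fun w hw => by
    simp [h w ((Finsupp.mem_supported _ _).1 hx hw)]

lemma map_eq_self_of_carried {R : V → V → Prop} {f : V → V} (h : ∀ u, R u u → f u = u)
    {x : WordChain V} (hx : x ∈ carried R) : map f x = x := by
  refine (Finsupp.mapDomain_congr (g := id) fun w hw => ?_).trans Finsupp.mapDomain_id
  have hw' := (Finsupp.mem_supported _ _).1 hx hw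
  exact (List.map_congr_left fun u hu => h u (hw' u hu u hu)).trans (List.map_id w)

/-- If every `σ j` takes different values at `u` and `f u`, then the sign-change cochain is
invariant under `f`, and the primitive changes by the sign-change cochain. -/
lemma eval_signPrimitive_add_map {σ : ℕ → V → ZMod 2} {f : V → V} {R : V → V → Prop}
    (h : ∀ j u, R u u → σ j (f u) = σ j u + 1) (j : ℕ) {x : WordChain V} (hx : x ∈ carried R) :
    eval (signPrimitive σ j) (x + map f x) = eval (signChanges σ j) x := by
  have hinv : ∀ (j : ℕ) (w : List V), (∀ u ∈ w, ∀ v ∈ w, R u v) →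
      signChanges σ j (w.map f) = signChanges σ j w := by
    intro j
    induction j with
    | zero => rintro (_ | ⟨u, _ | ⟨v, w⟩⟩) _ <;> rfl
    | succ j ih =>
      rintro (_ | ⟨u, _ | ⟨v, w⟩⟩) hw
      · rfl
      · rfl
      · have := ih (v :: w) fun a ha b hb =>
          hw a (List.mem_cons_of_mem u ha) b (List.mem_cons_of_mem u hb)
        simp only [List.map_cons] at this
        simp only [List.map_cons, signChanges, this, h j u (hw u (by simp) u (by simp)),
          h j v (hw v (by simp) v (by simp))]
        linear_combination signChanges σ j (v :: w) * (CharTwo.two_eq_zero (R := ZMod 2))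
  have key : eval (signPrimitive σ j) (x + map f x) - eval (signChanges σ j) x
      = eval (fun w => signPrimitive σ j w + signPrimitive σ j (w.map f) - signChanges σ j w)
        x := by
    have : eval (signPrimitive σ j) ∘ₗ (LinearMap.id + map f) - eval (signChanges σ j)
      = eval (fun w => signPrimitive σ j w + signPrimitive σ j (w.map f) - signChanges σ j w) :=
      hom_ext fun w => by simp
    exact LinearMap.congr_fun this x
  rw [← sub_eq_zero, key]
  refine eq_zero_of_carried (fun w hw => ?_) hx
  rcases w with _ | ⟨u, w⟩
  · simp [signPrimitive, signChanges_nil]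
  · have h1 := hinv j _ hw
    simp only [List.map_cons] at h1
    simp only [List.map_cons, signPrimitive, h1, h j u (hw u (by simp) u (by simp))]
    linear_combination σ j u * signChanges σ j (u :: w) * (CharTwo.two_eq_zero (R := ZMod 2))

/-- A sign-change cochain that does not vanish on a word detects a sign change of each `σ i`. -/
lemma exists_ne_of_signChanges_ne_zero {σ : ℕ → V → ZMod 2} {j : ℕ} {w : List V}
    (h : signChanges σ j w ≠ 0) {i : ℕ} (hi : i < j) : ∃ u ∈ w, ∃ v ∈ w, σ i u ≠ σ i v := by
  induction j generalizing w with
  | zero => omega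
  | succ j ih =>
    rcases w with _ | ⟨u, _ | ⟨v, w⟩⟩
    · exact absurd rfl h
    · exact absurd rfl h
    rw [signChanges] at h
    rcases Nat.lt_succ_iff_lt_or_eq.1 hi with hi | rfl
    · obtain ⟨a, ha, b, hb, hab⟩ := ih (right_ne_zero_of_mul h) hi
      exact ⟨a, List.mem_cons_of_mem u ha, b, List.mem_cons_of_mem u hb, hab⟩
    · refine ⟨u, by simp, v, by simp, fun huv => left_ne_zero_of_mul h ?_⟩
      rw [huv, CharTwo.add_self_eq_zero]

/-! ### A triangulated sphere with an antipodal filtration -/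

/-- Moves a point of the integer lattice to height `a` in the coordinate direction `j`. -/
def slice (j : ℕ) (a : ℤ) (v : ℕ → ℤ) : ℕ → ℤ := Function.update v j a

/-- The triangulated product of a chain with the interval `[0, m]` in direction `j`. -/
noncomputable def sweep (m j : ℕ) : WordChain (ℕ → ℤ) →ₗ[ZMod 2] WordChain (ℕ → ℤ) :=
  ∑ a ∈ Finset.range m, prism (slice j a) (slice j (a + 1 : ℤ))

/-- The cube `[-m, m]ʲ` in the first `j` coordinate directions, triangulated invariantly under
the antipodal map. -/
noncomputable def disk (m : ℕ) : ℕ → WordChain (ℕ → ℤ)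
  | 0 => Finsupp.single [0] 1
  | j + 1 => sweep m j (disk m j) + map (- ·) (sweep m j (disk m j))

/-- The upper half of the boundary of `[-m, m]ʲ⁺¹`. -/
noncomputable def cap (m j : ℕ) : WordChain (ℕ → ℤ) :=
  map (slice j m) (disk m j) + sweep m j (boundary (disk m j))

/-- Adjacency of vertices in `[-m, m]ʲ`; that they lie in the cube is only demanded of the first
one, since `carried` uses the relation in both orders. -/
def diskRel (m j : ℕ) (u v : ℕ → ℤ) : Prop :=
  (∀ i, |u i - v i| ≤ 1) ∧ (∀ i, |u i| ≤ m) ∧ ∀ i, j ≤ i → u i = 0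

/-- Adjacency of vertices in the boundary of `[-m, m]ʲ`. -/
def sphereRel (m j : ℕ) (u v : ℕ → ℤ) : Prop :=
  diskRel m j u v ∧ ∃ i, |u i| = m

lemma boundary_sweep (m j : ℕ) (x : WordChain (ℕ → ℤ)) :
    boundary (sweep m j x)
      = map (slice j 0) x + map (slice j m) x + sweep m j (boundary x) := by
  induction m with
  | zero => simp [sweep, ZModModule.add_self]
  | succ m ih =>
    have e (y : WordChain (ℕ → ℤ)) : sweep (m + 1) j y
        = sweep m j y + prism (slice j m) (slice j (m + 1 : ℤ)) y := by
      simp [sweep, Finset.sum_range_succ]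
    rw [e, e, map_add, ih, boundary_prism, Nat.cast_succ]
    have h2 := ZModModule.add_self (map (slice j (m : ℤ)) x)
    rw [← sub_eq_zero, ← h2]
    abel

lemma abs_slice_sub_slice_le {j : ℕ} {a b : ℤ} (hab : |a - b| ≤ 1) {u v : ℕ → ℤ}
    (h : ∀ i, |u i - v i| ≤ 1) (i : ℕ) : |slice j a u i - slice j b v i| ≤ 1 := by
  by_cases hi : i = j
  · subst hi; simpa [slice] using hab
  · simpa [slice, hi] using h i

lemma diskRel_slice {m j : ℕ} {a b : ℤ} (hab : |a - b| ≤ 1) (ha : |a| ≤ m) {u v : ℕ → ℤ}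
    (h : diskRel m j u v) : diskRel m (j + 1) (slice j a u) (slice j b v) := by
  refine ⟨abs_slice_sub_slice_le hab h.1, fun i => ?_, fun i hi => ?_⟩
  · by_cases hi : i = j
    · subst hi; simpa [slice] using ha
    · simpa [slice, hi] using h.2.1 i
  · have : i ≠ j := by omega
    simpa [slice, this] using h.2.2 i (by omega)

lemma sphereRel_slice {m j : ℕ} (hm : 0 < m) {a b : ℤ} (hab : |a - b| ≤ 1) (ha : |a| ≤ m)
    {u v : ℕ → ℤ} (h : sphereRel m j u v) :
    sphereRel m (j + 1) (slice j a u) (slice j b v) := by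
  obtain ⟨h, i, hi⟩ := h
  refine ⟨diskRel_slice hab ha h, i, ?_⟩
  have : i ≠ j := by
    rintro rfl
    rw [h.2.2 i le_rfl] at hi
    simp at hi; omega
  simpa [slice, this] using hi

lemma sweep_mem_carried {m j : ℕ} {R R' : (ℕ → ℤ) → (ℕ → ℤ) → Prop}
    (h : ∀ (a b : ℤ) u v, |a - b| ≤ 1 → |a| ≤ m → R u v → R' (slice j a u) (slice j b v))
    {x : WordChain (ℕ → ℤ)} (hx : x ∈ carried R) : sweep m j x ∈ carried R' := by
  rw [sweep, LinearMap.sum_apply]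
  refine Submodule.sum_mem _ fun a ha => prism_mem_carried (fun u v huv => ?_) hx
  have := Finset.mem_range.1 ha
  have h1 : |(a : ℤ)| ≤ m := by rw [abs_le]; omega
  have h2 : |(a + 1 : ℤ)| ≤ m := by rw [abs_le]; omega
  exact ⟨h _ _ u v (by simp) h1 huv, h _ _ u v (by simp) h1 huv, h _ _ u v (by simp) h2 huv,
    h _ _ u v (by simp) h2 huv⟩

lemma diskRel_neg {m j : ℕ} {u v : ℕ → ℤ} (h : diskRel m j u v) : diskRel m j (-u) (-v) := by
  refine ⟨fun i => ?_, fun i => ?_, fun i hi => ?_⟩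
  · rw [Pi.neg_apply, Pi.neg_apply, neg_sub_neg, abs_sub_comm]; exact h.1 i
  · simpa using h.2.1 i
  · simpa using h.2.2 i hi

lemma sphereRel_neg {m j : ℕ} {u v : ℕ → ℤ} (h : sphereRel m j u v) :
    sphereRel m j (-u) (-v) :=
  ⟨diskRel_neg h.1, by simpa using h.2⟩

lemma disk_mem_carried (m j : ℕ) : disk m j ∈ carried (diskRel m j) := by
  induction j with
  | zero => exact single_mem_carried (by simp [diskRel])
  | succ j ih =>
    have h : sweep m j (disk m j) ∈ carried (diskRel m (j + 1)) :=
      sweep_mem_carried (fun a b u v hab ha => diskRel_slice hab ha) ih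
    have h' : map (- ·) (sweep m j (disk m j)) ∈ carried (diskRel m (j + 1)) :=
      map_mem_carried (fun _ _ huv => diskRel_neg huv) h
    rw [disk]
    exact Submodule.add_mem _ h h'

lemma map_neg_disk (m j : ℕ) : map (- ·) (disk m j) = disk m j := by
  cases j with
  | zero => simp [disk]
  | succ j =>
    have h : ((- ·) ∘ (- ·) : (ℕ → ℤ) → ℕ → ℤ) = id := by funext; simp
    rw [disk, map_add, map_map, h, add_comm]
    congr 1
    exact Finsupp.mapDomain_congr (g := id) (fun w _ => List.map_id w) |>.trans
      Finsupp.mapDomain_id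

lemma map_slice_zero {m j : ℕ} {x : WordChain (ℕ → ℤ)} (hx : x ∈ carried (diskRel m j)) :
    map (slice j 0) x = x :=
  map_eq_self_of_carried (fun _ hu => Function.update_eq_self_iff.2 (hu.2.2 j le_rfl).symm) hx

/-- The boundary of the cube is the union of its upper half and the antipodal one. -/
lemma boundary_disk_succ (m j : ℕ) :
    boundary (disk m (j + 1)) = cap m j + map (- ·) (cap m j) := by
  have h : boundary (sweep m j (disk m j)) = disk m j + cap m j := by
    rw [boundary_sweep, map_slice_zero (disk_mem_carried m j), cap, add_assoc]
  rw [disk, map_add, boundary_map, h, map_add, map_neg_disk]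
  have h2 := ZModModule.add_self (disk m j)
  rw [← sub_eq_zero, ← h2]
  abel

/-- The boundary of a half sphere is the equator. -/
lemma boundary_cap_succ (m j : ℕ) :
    boundary (cap m (j + 1)) = cap m j + map (- ·) (cap m j) := by
  rw [cap, map_add, boundary_map, boundary_sweep, boundary_boundary, map_zero, add_zero,
    map_slice_zero (boundary_mem_carried (disk_mem_carried m (j + 1))), ← boundary_disk_succ]
  have h2 := ZModModule.add_self (map (slice (j + 1) m) (boundary (disk m (j + 1))))
  rw [← sub_eq_zero, ← h2]
  abel

lemma cap_mem_carried {m : ℕ} (hm : 0 < m) (j : ℕ) :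
    cap m j ∈ carried (sphereRel m (j + 1)) := by
  have htop (j : ℕ) : map (slice j m) (disk m j) ∈ carried (sphereRel m (j + 1)) :=
    map_mem_carried (fun u v h => ⟨diskRel_slice (by simp) (by simp) h, j, by simp [slice]⟩)
      (disk_mem_carried m j)
  induction j with
  | zero =>
    have : sweep m 0 (boundary (disk m 0)) = 0 := by
      simp [sweep, disk, wordBoundary, wordPrism]
    rw [cap, this, add_zero]
    exact htop 0
  | succ j ih =>
    have h' : map (- ·) (cap m j) ∈ carried (sphereRel m (j + 1)) :=
      map_mem_carried (fun _ _ huv => sphereRel_neg huv) ih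
    rw [cap]
    refine Submodule.add_mem _ (htop (j + 1)) ?_
    rw [boundary_disk_succ]
    exact sweep_mem_carried (fun a b u v hab ha huv => sphereRel_slice hm hab ha huv)
      (Submodule.add_mem _ ih h')

/-- For antipodal sign functions, the number of simplices of the half sphere along which the
signs change one after the other is odd. -/
lemma eval_signChanges_cap {m : ℕ} (hm : 0 < m) {σ : ℕ → (ℕ → ℤ) → ZMod 2}
    (hσ : ∀ j u, u ≠ 0 → σ j (-u) = σ j u + 1) (j : ℕ) :
    eval (signChanges σ j) (cap m j) = 1 := by
  induction j with
  | zero => simp [cap, sweep, disk, wordBoundary, wordPrism, signChanges]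
  | succ j ih =>
    rw [← eval_signPrimitive_boundary, boundary_cap_succ,
      eval_signPrimitive_add_map _ j (cap_mem_carried hm j), ih]
    rintro j u ⟨_, i, hi⟩
    refine hσ j u ?_
    rintro rfl
    simp at hi
    omega

/-- **Combinatorial Borsuk–Ulam theorem.** Given `n` antipodal sign functions on the boundary of
`[-m, m]ⁿ⁺¹`, there is a set of pairwise adjacent vertices on which each of them changes. -/
theorem exists_sign_changes {m : ℕ} (hm : 0 < m) (n : ℕ) {σ : ℕ → (ℕ → ℤ) → ZMod 2}
    (hσ : ∀ j u, u ≠ 0 → σ j (-u) = σ j u + 1) :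
    ∃ w : List (ℕ → ℤ), w ≠ [] ∧ (∀ u ∈ w, ∀ v ∈ w, sphereRel m (n + 1) u v) ∧
      ∀ i < n, ∃ u ∈ w, ∃ v ∈ w, σ i u ≠ σ i v := by
  by_contra! hcon
  have h1 := eval_signChanges_cap hm hσ n
  rw [eq_zero_of_carried (fun w hw => ?_) (cap_mem_carried hm n)] at h1
  · exact zero_ne_one h1
  · by_contra hne
    have hw0 : w ≠ [] := by
      rintro rfl
      exact hne (signChanges_nil σ n)
    obtain ⟨i, hi, h⟩ := hcon w hw0 hw
    obtain ⟨u, hu, v, hv, huv⟩ := exists_ne_of_signChanges_ne_zero hne hi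
    exact huv (h u hu v hv)

end WordChain

/-! ### The Borsuk–Ulam theorem -/

/-- A sign function for the odd map `g`, with values in `ZMod 2`; at the zeros of `g` the sign is
chosen by comparing `u` with `-u` in a well-order. -/
noncomputable def tieBreakSign (g : (ℕ → ℤ) → ℝ) (u : ℕ → ℤ) : ZMod 2 :=
  open Classical in if 0 < g u ∨ g u = 0 ∧ WellOrderingRel u (-u) then 1 else 0

lemma tieBreakSign_neg {g : (ℕ → ℤ) → ℝ} (hg : ∀ u, g (-u) = -g u) {u : ℕ → ℤ} (hu : u ≠ 0) :
    tieBreakSign g (-u) = tieBreakSign g u + 1 := by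
  have hne : u ≠ -u := fun h => hu (self_eq_neg.1 h)
  have h11 : (1 : ZMod 2) + 1 = 0 := CharTwo.add_self_eq_zero 1
  have hanti : WellOrderingRel u (-u) → ¬ WellOrderingRel (-u) u := fun h h' =>
    asymm_of WellOrderingRel h h'
  have htot : WellOrderingRel u (-u) ∨ WellOrderingRel (-u) u := by
    rcases trichotomous_of WellOrderingRel u (-u) with h | h | h
    · exact Or.inl h
    · exact absurd h hne
    · exact Or.inr h
  simp only [tieBreakSign, neg_neg]
  rw [hg u]
  rcases lt_trichotomy (g u) 0 with h | h | h
  · simp [h, h.not_gt, h.ne]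
  · by_cases hw : WellOrderingRel u (-u)
    · simp [h, hw, hanti hw, h11]
    · simp [h, hw, htot.resolve_left hw]
  · simp [h, h.le, h.ne', h11]

lemma exists_nonneg_nonpos_of_tieBreakSign_ne {g : (ℕ → ℤ) → ℝ} {w : List (ℕ → ℤ)}
    (h : ∃ u ∈ w, ∃ v ∈ w, tieBreakSign g u ≠ tieBreakSign g v) :
    (∃ u ∈ w, 0 ≤ g u) ∧ ∃ v ∈ w, g v ≤ 0 := by
  obtain ⟨u, hu, v, hv, huv⟩ := h
  constructor
  · by_contra! hneg
    refine huv ?_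
    simp [tieBreakSign, (hneg u hu).not_gt, (hneg v hv).not_gt, (hneg u hu).ne, (hneg v hv).ne]
  · by_contra! hpos
    refine huv ?_
    simp [tieBreakSign, hpos u hu, hpos v hv]

/-- **Borsuk–Ulam theorem** (for the unit sphere of the supremum norm). -/
theorem exists_zero_of_odd {n : ℕ} {f : (Fin (n + 1) → ℝ) → Fin n → ℝ} (hf : Continuous f)
    (hodd : ∀ x, f (-x) = -f x) : ∃ x, ‖x‖ = 1 ∧ f x = 0 := by
  by_contra! hcon
  have hcomp : IsCompact (Metric.sphere (0 : Fin (n + 1) → ℝ) 1) := isCompact_sphere 0 1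
  have hne : (Metric.sphere (0 : Fin (n + 1) → ℝ) 1).Nonempty :=
    NormedSpace.sphere_nonempty.2 zero_le_one
  obtain ⟨x₀, hx₀, hmin⟩ := hcomp.exists_isMinOn hne hf.norm.continuousOn
  have hε : 0 < ‖f x₀‖ := norm_pos_iff.2 (hcon x₀ (by simpa using hx₀))
  obtain ⟨δ, hδ, hfδ⟩ := Metric.uniformContinuousOn_iff.1
    (hcomp.uniformContinuousOn_of_continuous hf.continuousOn) _ hε
  obtain ⟨N, hN⟩ := exists_nat_one_div_lt hδ
  set m : ℕ := N + 1
  have hm : (0 : ℝ) < m := by positivity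
  let p : (ℕ → ℤ) → Fin (n + 1) → ℝ := fun u k => (u k : ℝ) / m
  have hp (u : ℕ → ℤ) : p (-u) = -p u := by ext k; simp [p, neg_div]
  let g : ℕ → (ℕ → ℤ) → ℝ := fun i u => if h : i < n then f (p u) ⟨i, h⟩ else 0
  have hg (i : ℕ) (u : ℕ → ℤ) : g i (-u) = -g i u := by
    by_cases h : i < n <;> simp [g, h, hp, hodd]
  obtain ⟨w, hw0, hw, hsign⟩ := WordChain.exists_sign_changes (Nat.succ_pos N) n
    (σ := fun i => tieBreakSign (g i)) fun i u hu => tieBreakSign_neg (hg i) hu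
  have hsphere : ∀ u ∈ w, p u ∈ Metric.sphere (0 : Fin (n + 1) → ℝ) 1 := by
    intro u hu
    obtain ⟨⟨-, hle, hzero⟩, i, hi⟩ := hw u hu u hu
    rw [mem_sphere_zero_iff_norm]
    have habs (k : Fin (n + 1)) : ‖p u k‖ = ((|u k| : ℤ) : ℝ) / m := by
      simp [p]
    refine le_antisymm ((pi_norm_le_iff_of_nonneg zero_le_one).2 fun k => ?_) ?_
    · rw [habs, div_le_one hm]
      exact_mod_cast hle k
    · have hin : i < n + 1 := by
        by_contra h
        rw [hzero i (by omega)] at hi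
        simp at hi
        omega
      have h1 := norm_le_pi_norm (p u) ⟨i, hin⟩
      rw [habs] at h1
      simp only [hi] at h1
      rwa [Int.cast_natCast, div_self hm.ne'] at h1
  have hdist : ∀ u ∈ w, ∀ v ∈ w, dist (f (p u)) (f (p v)) < ‖f x₀‖ := by
    intro u hu v hv
    refine hfδ _ (hsphere u hu) _ (hsphere v hv) (lt_of_le_of_lt ?_ hN)
    refine (dist_pi_le_iff (by positivity)).2 fun k => ?_
    have h1 : (|(u k : ℝ) - v k|) ≤ 1 := by exact_mod_cast (hw u hu v hv).1.1 k
    rw [Real.dist_eq, ← sub_div, abs_div, abs_of_pos hm]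
    simpa [m] using div_le_div_of_nonneg_right h1 hm.le
  obtain ⟨v, hv⟩ := List.exists_mem_of_ne_nil w hw0
  have hlt : ‖f (p v)‖ < ‖f x₀‖ := by
    refine (pi_norm_lt_iff hε).2 fun i => ?_
    obtain ⟨⟨a, ha, ha0⟩, b, hb, hb0⟩ := exists_nonneg_nonpos_of_tieBreakSign_ne (hsign i i.2)
    simp only [g, i.2, dite_true, Fin.eta] at ha0 hb0
    have h1 := lt_of_le_of_lt (dist_le_pi_dist (f (p v)) (f (p a)) i) (hdist v hv a ha)
    have h2 := lt_of_le_of_lt (dist_le_pi_dist (f (p v)) (f (p b)) i) (hdist v hv b hb)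
    rw [Real.dist_eq, abs_lt] at h1 h2
    rw [Real.norm_eq_abs, abs_lt]
    constructor <;> linarith
  exact absurd (hmin (hsphere v hv)) (not_le.2 hlt)

/-- The Borsuk–Ulam theorem for maps between finite-dimensional real normed spaces. -/
theorem exists_zero_of_odd_of_finrank {E F : Type} [NormedAddCommGroup E] [NormedSpace ℝ E]
    [FiniteDimensional ℝ E] [NormedAddCommGroup F] [NormedSpace ℝ F] [FiniteDimensional ℝ F]
    (h : Module.finrank ℝ E = Module.finrank ℝ F + 1) {f : E → F} (hf : Continuous f)
    (hodd : ∀ x, f (-x) = -f x) : ∃ x, x ≠ 0 ∧ f x = 0 := by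
  let eE : E ≃L[ℝ] (Fin (Module.finrank ℝ F + 1) → ℝ) :=
    ContinuousLinearEquiv.ofFinrankEq (by simp [h])
  let eF : F ≃L[ℝ] (Fin (Module.finrank ℝ F) → ℝ) := ContinuousLinearEquiv.ofFinrankEq (by simp)
  obtain ⟨x, hx, hfx⟩ := exists_zero_of_odd (f := fun x => eF (f (eE.symm x)))
    (by fun_prop) (fun x => by simp [hodd])
  refine ⟨eE.symm x, fun h0 => ?_, by simpa using hfx⟩
  have : x = 0 := by simpa using h0
  simp [this] at hx

/-! ### Odd maps on a sphere that decompose -/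

/-- The extension of a map on the unit sphere that is positively homogeneous of degree one. -/
noncomputable def radialExtension {E F : Type} [NormedAddCommGroup E] [NormedSpace ℝ E]
    [AddCommGroup F] [Module ℝ F] (a : Metric.sphere (0 : E) 1 → F) (y : E) : F :=
  open Classical in
  if h : y = 0 then 0 else ‖y‖ • a ⟨‖y‖⁻¹ • y, by simp [norm_smul, h]⟩

section RadialExtension

variable {E F : Type} [NormedAddCommGroup E] [NormedSpace ℝ E] [NormedAddCommGroup F]
  [NormedSpace ℝ F] {a : Metric.sphere (0 : E) 1 → F}

@[simp] lemma radialExtension_zero : radialExtension a 0 = 0 := by simp [radialExtension]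

lemma radialExtension_eq {y : E} (hy : y ≠ 0) :
    ∃ x : Metric.sphere (0 : E) 1, ∀ (F : Type) [NormedAddCommGroup F] [NormedSpace ℝ F]
      (a : Metric.sphere (0 : E) 1 → F),
      radialExtension a y = ‖y‖ • a x ∧ radialExtension a (-y) = ‖y‖ • a (-x) := by
  refine ⟨⟨‖y‖⁻¹ • y, by simp [norm_smul, hy]⟩, fun F _ _ a => ⟨by simp [radialExtension, hy], ?_⟩⟩
  simp only [radialExtension, neg_eq_zero, hy, dite_false, norm_neg]
  congr 2
  ext
  simp

lemma continuous_radialExtension [FiniteDimensional ℝ E] (ha : Continuous a) :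
    Continuous (radialExtension a) := by
  obtain ⟨C, hC⟩ := isCompact_univ.exists_bound_of_continuousOn (f := a) ha.continuousOn
  have hb (y : E) : ‖radialExtension a y‖ ≤ ‖y‖ * C := by
    by_cases hy : y = 0
    · simp [hy]
    · obtain ⟨x, hx⟩ := radialExtension_eq hy
      rw [(hx F a).1, norm_smul, norm_norm]
      exact mul_le_mul_of_nonneg_left (hC x trivial) (norm_nonneg y)
  refine continuous_iff_continuousAt.2 fun y => ?_
  by_cases hy : y = 0
  · subst hy
    rw [ContinuousAt, radialExtension_zero]
    refine squeeze_zero_norm hb ?_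
    have : Continuous fun y : E => ‖y‖ * C := by fun_prop
    simpa using this.tendsto 0
  · have hopen : IsOpen {y : E | y ≠ 0} := isOpen_ne
    refine ContinuousOn.continuousAt (s := {y : E | y ≠ 0}) ?_ (hopen.mem_nhds hy)
    rw [continuousOn_iff_continuous_domRestrict]
    have e : {y : E | y ≠ 0}.domRestrict (radialExtension a) =
        fun z : {y : E | y ≠ 0} => ‖(z : E)‖ •
          a ⟨‖(z : E)‖⁻¹ • (z : E), by simp [norm_smul, show (z : E) ≠ 0 from z.2]⟩ := by
      ext z
      simp [radialExtension, show (z : E) ≠ 0 from z.2]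
    rw [e]
    refine continuous_subtype_val.norm.smul (ha.comp (Continuous.subtype_mk ?_ _))
    exact (continuous_subtype_val.norm.inv₀ fun z => norm_ne_zero_iff.2 z.2).smul
      continuous_subtype_val

end RadialExtension

/-- There are no maps `a` and `b` on the unit sphere of a space of dimension `dim A + dim B` such
that `a` is odd, `b` has no zeros, and `b` is odd at the zeros of `a`: the segments from
`(a x, b x)` to `(a x, -b (-x))` avoid zero and are interchanged with a sign by the antipodal map,
and both ends can be contracted by pushing them in a direction of `A`, so that an odd map without
zeros arises on a sphere of one dimension more. -/
theorem false_of_odd_of_ne_zero {E A B : Type}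
    [NormedAddCommGroup E] [NormedSpace ℝ E] [FiniteDimensional ℝ E]
    [NormedAddCommGroup A] [NormedSpace ℝ A] [FiniteDimensional ℝ A]
    [NormedAddCommGroup B] [NormedSpace ℝ B] [FiniteDimensional ℝ B]
    (hdim : Module.finrank ℝ E = Module.finrank ℝ A + Module.finrank ℝ B) [Nontrivial A]
    {a : Metric.sphere (0 : E) 1 → A} {b : Metric.sphere (0 : E) 1 → B}
    (ha : Continuous a) (hb : Continuous b) (ha_odd : ∀ x, a (-x) = -a x)
    (hb_ne : ∀ x, b x ≠ 0) (hab : ∀ x, a x = 0 → b (-x) = -b x) : False := by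
  obtain ⟨q, hq⟩ := exists_ne (0 : A)
  let c : ℝ → ℝ → ℝ := fun r t => max (-r) (min r t)
  have hc_odd {r : ℝ} (hr : 0 ≤ r) (t : ℝ) : c r (-t) = -c r t := by
    simp only [c, max_def, min_def]
    split_ifs <;> linarith
  -- The homotopy is defined where `-‖y‖ ≤ t ≤ ‖y‖`, and takes place at time `t / ‖y‖`; outside
  -- this region the first component is pushed along `q`.
  let f : E × ℝ → A × B := fun z =>
    (radialExtension a z.1 + (z.2 - c ‖z.1‖ z.2) • q,
      (‖z.1‖ + c ‖z.1‖ z.2) • radialExtension b z.1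
        - (‖z.1‖ - c ‖z.1‖ z.2) • radialExtension b (-z.1))
  have hA := continuous_radialExtension ha
  have hB := continuous_radialExtension hb
  have hf : Continuous f := by
    have : Continuous fun z : E × ℝ => c ‖z.1‖ z.2 := by fun_prop
    fun_prop
  obtain ⟨⟨y, t⟩, hne, hz⟩ := exists_zero_of_odd_of_finrank (E := E × ℝ) (F := A × B)
    (by simp [hdim]) hf (by
      rintro ⟨y, t⟩
      have : radialExtension a (-y) = -radialExtension a y := by
        by_cases hy : y = 0
        · simp [hy]
        · obtain ⟨x, hx⟩ := radialExtension_eq hy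
          rw [(hx A a).1, (hx A a).2, ha_odd, smul_neg]
      simp only [f, Prod.neg_mk, norm_neg, hc_odd (norm_nonneg y), this, neg_neg, Prod.mk.injEq]
      constructor <;> module)
  simp only [f, Prod.mk_eq_zero] at hz
  obtain ⟨h1, h2⟩ := hz
  by_cases hy : y = 0
  · subst hy
    have ht : t ≠ 0 := by rintro rfl; exact hne rfl
    have hc0 : c 0 t = 0 := by simp [c]
    simp [hc0, hq, ht] at h1
  · obtain ⟨x, hx⟩ := radialExtension_eq hy
    have hr : 0 < ‖y‖ := norm_pos_iff.2 hy
    rw [(hx A a).1] at h1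
    rw [(hx B b).1, (hx B b).2] at h2
    rcases lt_or_ge ‖y‖ t with ht | ht
    · have hct : c ‖y‖ t = ‖y‖ := by simp [c, ht.le, hr.le]
      simp [hct, hb_ne, hr.ne', ← two_mul] at h2
    rcases lt_or_ge t (-‖y‖) with ht' | ht'
    · have hct : c ‖y‖ t = -‖y‖ := by simp [c, ht'.le]
      simp [hct, hy, hb_ne, ← two_mul] at h2
    have hct : c ‖y‖ t = t := by simp [c, ht, ht']
    have hax : a x = 0 := by simpa [hct, hy] using h1
    rw [hab x hax, hct] at h2
    have h3 : (2 * ‖y‖ * ‖y‖) • b x = 0 := by rw [← h2]; module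
    simp [hy, hb_ne] at h3

/-! ### Oblique projections -/

section Oblique

variable {𝕜 E : Type} [RCLike 𝕜] [NormedAddCommGroup E] [InnerProductSpace 𝕜 E]
  [FiniteDimensional 𝕜 E]

/-- The projection onto `V` along a complement `W`, expressed through the orthogonal projections
onto `V` and `W`. It is only meaningful if `V` and `W` are complementary. -/
noncomputable def obliqueProjection (V W : Submodule 𝕜 E) : E →L[𝕜] E :=
  V.starProjection * Ring.inverse (V.starProjection - W.starProjection)

lemma isUnit_starProjection_sub {V W : Submodule 𝕜 E} (h : IsCompl V W) :
    IsUnit (V.starProjection - W.starProjection) := by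
  have hinj : Function.Injective (V.starProjection - W.starProjection : E →L[𝕜] E) := by
    refine (injective_iff_map_eq_zero _).2 fun v hv => ?_
    have heq : V.starProjection v = W.starProjection v := sub_eq_zero.1 hv
    have h0 : V.starProjection v = 0 := by
      refine Submodule.disjoint_def.1 h.disjoint _ (V.starProjection_apply_mem v) ?_
      rw [heq]
      exact W.starProjection_apply_mem v
    have hV := V.starProjection_apply_eq_zero_iff.1 h0
    have hW := W.starProjection_apply_eq_zero_iff.1 (heq ▸ h0)
    have : v ∈ (V ⊔ W)ᗮ := by
      rw [← Submodule.inf_orthogonal]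
      exact ⟨hV, hW⟩
    simpa [h.sup_eq_top] using this
  have := FiniteDimensional.complete 𝕜 E
  refine ContinuousLinearMap.isUnit_iff_bijective.2 ⟨hinj, ?_⟩
  exact LinearMap.injective_iff_surjective.1 hinj

lemma obliqueProjection_mem (V W : Submodule 𝕜 E) (z : E) : obliqueProjection V W z ∈ V :=
  V.starProjection_apply_mem _

lemma sub_obliqueProjection_mem {V W : Submodule 𝕜 E} (h : IsCompl V W) (z : E) :
    z - obliqueProjection V W z ∈ W := by
  set D := V.starProjection - W.starProjection
  have hD : D (Ring.inverse D z) = z :=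
    DFunLike.congr_fun (Ring.mul_inverse_cancel D (isUnit_starProjection_sub h)) z
  have : z - obliqueProjection V W z = -W.starProjection (Ring.inverse D z) := by
    nth_rewrite 1 [← hD]
    simp [D, obliqueProjection]
  rw [this]
  exact W.neg_mem (W.starProjection_apply_mem _)

lemma obliqueProjection_eq_of_mem {V W : Submodule 𝕜 E} (h : IsCompl V W) {z v : E} (hv : v ∈ V)
    (hz : z - v ∈ W) : obliqueProjection V W z = v := by
  rw [← sub_eq_zero]
  refine Submodule.disjoint_def.1 h.disjoint _ (V.sub_mem (obliqueProjection_mem V W z) hv) ?_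
  have := W.sub_mem hz (sub_obliqueProjection_mem h z)
  rwa [sub_sub_sub_cancel_left] at this

lemma continuous_obliqueProjection {X : Type} [TopologicalSpace X] {V W : X → Submodule 𝕜 E}
    (hV : Continuous fun x => (V x).starProjection)
    (hW : Continuous fun x => (W x).starProjection) (h : ∀ x, IsCompl (V x) (W x)) :
    Continuous fun x => obliqueProjection (V x) (W x) := by
  have := FiniteDimensional.complete 𝕜 E
  refine hV.mul (continuous_iff_continuousAt.2 fun x => ?_)
  obtain ⟨D, hD⟩ := isUnit_starProjection_sub (h x)
  have h1 := NormedRing.inverse_continuousAt D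
  rw [hD] at h1
  exact ContinuousAt.comp (f := fun x => (V x).starProjection - (W x).starProjection) h1
    (hV.sub hW).continuousAt

end Oblique

/-! ### Transverse spheres are maximal -/

lemma Gr.continuous_starProjection (𝕜 : Type) [RCLike 𝕜] (d k : ℕ) :
    Continuous fun V : Gr 𝕜 d k => V.space.starProjection :=
  continuous_induced_dom

lemma Gr.ext {𝕜 : Type} [RCLike 𝕜] {d k : ℕ} {V W : Gr 𝕜 d k} (h : V.space = W.space) : V = W :=
  Subtype.ext h

/-- A transverse set does not properly contain a sphere of real dimension
`dim_ℝ 𝕜 * (d - k) - 1`. For a pair `(V₀, W₀)` transverse to all pairs `(V x, W x)` of such a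
sphere, `V x` meets a fixed translate `u + W₀` in one vector `p x`. The class of `p x - p (-x)` in
`W₀ / V₀` is odd in `x`. The projection of `p x` to `V₀` along `W (-x)` never vanishes, and it is
equal to `p x - p (-x)` when that class is zero. -/
theorem false_of_transverse_sphere {𝕜 : Type} [RCLike 𝕜] {d k N : ℕ} (hd : 2 * k + 1 ≤ d)
    (hN : N + 1 = Module.finrank ℝ 𝕜 * (d - k))
    {Λ S : Set (Gr 𝕜 d k × Gr 𝕜 d (d - k))} (hΛ : IsTransverseSet Λ) (hS : S ⊂ Λ)
    (hsphere : IsTopologicalSphere N S) : False := by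
  obtain ⟨φ⟩ := hsphere
  obtain ⟨hflag, htrans⟩ := hΛ
  obtain ⟨⟨V₀, W₀⟩, hz₀, hz₀S⟩ := Set.exists_of_ssubset hS
  set X := Metric.sphere (0 : EuclideanSpace ℝ (Fin (N + 1))) 1
  let V : X → Gr 𝕜 d k := fun x => (φ.symm x).1.1
  let W : X → Gr 𝕜 d (d - k) := fun x => (φ.symm x).1.2
  have hmem (x : X) : (V x, W x) ∈ Λ := hS.1 (φ.symm x).2
  have hne₀ (x : X) : (V x, W x) ≠ (V₀, W₀) := fun h => hz₀S (h ▸ (φ.symm x).2)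
  have hVW (x : X) : (V x).space ≤ (W x).space := hflag _ (hmem x)
  have hV₀W₀ : V₀.space ≤ W₀.space := hflag _ hz₀
  have hVW₀ (x : X) : IsCompl (V x).space W₀.space := htrans _ (hmem x) _ hz₀ (hne₀ x)
  have hV₀W (x : X) : IsCompl V₀.space (W x).space := htrans _ hz₀ _ (hmem x) (hne₀ x).symm
  have hanti (x : X) : IsCompl (V x).space (W (-x)).space := by
    refine htrans _ (hmem x) _ (hmem (-x)) fun h => ?_
    have h1 : x = -x := φ.symm.injective (Subtype.ext h)
    have h2 : (x : EuclideanSpace ℝ (Fin (N + 1))) = -x := congrArg Subtype.val h1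
    refine ne_zero_of_mem_unit_sphere x ?_
    have h3 := eq_neg_iff_add_eq_zero.1 h2
    rwa [← two_smul ℝ, smul_eq_zero, or_iff_right two_ne_zero] at h3
  have hVcont : Continuous fun x => (V x).space.starProjection :=
    (Gr.continuous_starProjection 𝕜 d k).comp
      (continuous_fst.comp (continuous_subtype_val.comp φ.symm.continuous))
  have hWcont : Continuous fun x => (W x).space.starProjection :=
    (Gr.continuous_starProjection 𝕜 d (d - k)).comp
      (continuous_snd.comp (continuous_subtype_val.comp φ.symm.continuous))
  have hV₀rank : Module.finrank 𝕜 V₀.space = k := V₀.2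
  have hW₀rank : Module.finrank 𝕜 W₀.space = d - k := W₀.2
  -- If `W₀` is everything then `k = 0`, and there is only one pair in the product.
  have hW₀top : W₀.space ≠ ⊤ := by
    intro htop
    obtain ⟨x⟩ : Nonempty X :=
      (NormedSpace.sphere_nonempty (E := EuclideanSpace ℝ (Fin (N + 1)))).2 zero_le_one |>.to_subtype
    have hVx : (V x).space = ⊥ := by
      have := (hVW₀ x).disjoint
      rwa [htop, disjoint_top] at this
    have hk : k = 0 := by
      have : Module.finrank 𝕜 (V x).space = k := (V x).2
      rw [hVx, finrank_bot] at this
      exact this.symm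
    have hV₀ : V₀.space = ⊥ := Submodule.finrank_eq_zero.1 (hV₀rank.trans hk)
    have hWx : (W x).space = ⊤ := by
      have := (hV₀W x).codisjoint
      rwa [hV₀, bot_codisjoint] at this
    exact hne₀ x (Prod.ext (Gr.ext (hVx.trans hV₀.symm)) (Gr.ext (hWx.trans htop.symm)))
  obtain ⟨u, hu⟩ : ∃ u, u ∉ W₀.space := by
    by_contra! h
    exact hW₀top ((Submodule.eq_top_iff').2 h)
  let p : X → EuclideanSpace 𝕜 (Fin d) := fun x => obliqueProjection (V x).space W₀.space u
  have hpV (x : X) : p x ∈ (V x).space := obliqueProjection_mem _ _ _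
  have hpW₀ (x : X) : u - p x ∈ W₀.space := sub_obliqueProjection_mem (hVW₀ x) u
  have hp0 (x : X) : p x ≠ 0 := fun h => hu (by simpa [h] using hpW₀ x)
  have hpcont : Continuous p :=
    (continuous_obliqueProjection hVcont continuous_const hVW₀).clm_apply continuous_const
  have hdiff (x : X) : p x - p (-x) ∈ W₀.space := by
    have := W₀.space.sub_mem (hpW₀ (-x)) (hpW₀ x)
    rwa [sub_sub_sub_cancel_left] at this
  have hA (x : X) : V₀.spaceᗮ.starProjection (p x - p (-x)) ∈ V₀.spaceᗮ ⊓ W₀.space := by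
    refine ⟨Submodule.starProjection_apply_mem _ _, ?_⟩
    rw [Submodule.starProjection_orthogonal_val]
    exact W₀.space.sub_mem (hdiff x) (hV₀W₀ (Submodule.starProjection_apply_mem _ _))
  let A : Submodule 𝕜 (EuclideanSpace 𝕜 (Fin d)) := V₀.spaceᗮ ⊓ W₀.space
  let B : Submodule 𝕜 (EuclideanSpace 𝕜 (Fin d)) := V₀.space
  let a : X → A := fun x => ⟨V₀.spaceᗮ.starProjection (p x - p (-x)), hA x⟩
  let b : X → B := fun x =>
    ⟨obliqueProjection V₀.space (W (-x)).space (p x), obliqueProjection_mem _ _ _⟩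
  have hrank : k + Module.finrank 𝕜 A = d - k := by
    have := Submodule.finrank_add_inf_finrank_orthogonal hV₀W₀
    rwa [hV₀rank, hW₀rank] at this
  have : Nontrivial A := Module.nontrivial_of_finrank_pos (R := 𝕜) (by omega)
  have : FiniteDimensional ℝ A := FiniteDimensional.trans ℝ 𝕜 A
  have : FiniteDimensional ℝ B := FiniteDimensional.trans ℝ 𝕜 B
  refine false_of_odd_of_ne_zero (a := a) (b := b) ?_ ?_ ?_ ?_ ?_ ?_
  · rw [finrank_euclideanSpace_fin, hN, ← Module.finrank_mul_finrank ℝ 𝕜 A,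
      ← Module.finrank_mul_finrank ℝ 𝕜 B, ← mul_add, hV₀rank, add_comm, ← hrank, add_comm]
  · refine Continuous.subtype_mk ?_ _
    exact (ContinuousLinearMap.continuous _).comp (hpcont.sub (hpcont.comp continuous_neg))
  · refine Continuous.subtype_mk ?_ _
    refine Continuous.clm_apply ?_ hpcont
    exact continuous_obliqueProjection continuous_const (hWcont.comp continuous_neg)
      fun x => hV₀W (-x)
  · intro x
    ext1
    simp only [a, neg_neg, Submodule.coe_neg, ← map_neg, neg_sub]
  · intro x hbx
    have h0 : obliqueProjection V₀.space (W (-x)).space (p x) = 0 := congrArg Subtype.val hbx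
    have h1 := sub_obliqueProjection_mem (hV₀W (-x)) (p x)
    rw [h0, sub_zero] at h1
    exact hp0 x (Submodule.disjoint_def.1 (hanti x).disjoint _ (hpV x) h1)
  · intro x hax
    have h0 : V₀.spaceᗮ.starProjection (p x - p (-x)) = 0 := congrArg Subtype.val hax
    have h1 : p x - p (-x) ∈ V₀.space := by
      rw [Submodule.starProjection_apply_eq_zero_iff] at h0
      rwa [Submodule.orthogonal_orthogonal] at h0
    have h2 : obliqueProjection V₀.space (W (-x)).space (p x) = p x - p (-x) :=
      obliqueProjection_eq_of_mem (hV₀W (-x)) h1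
        (by rw [sub_sub_cancel]; exact hVW _ (hpV (-x)))
    have h3 : obliqueProjection V₀.space (W x).space (p (-x)) = p (-x) - p x :=
      obliqueProjection_eq_of_mem (hV₀W x) (by simpa using V₀.space.neg_mem h1)
        (by rw [sub_sub_cancel]; exact hVW _ (hpV x))
    ext1
    simp only [b, neg_neg, Submodule.coe_neg, h2, h3, neg_sub]

theorem theorem5p3 (d k : ℕ) (hd : 2 * k + 1 ≤ d) :
    (¬ ∃ Λ : Set (Gr ℝ d k × Gr ℝ d (d - k)), IsTransverseSet Λ ∧
        ∃ S : Set (Gr ℝ d k × Gr ℝ d (d - k)),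
          S ⊂ Λ ∧ IsTopologicalSphere (1 * (d - k) - 1) S) ∧
    (¬ ∃ Λ : Set (Gr ℂ d k × Gr ℂ d (d - k)), IsTransverseSet Λ ∧
        ∃ S : Set (Gr ℂ d k × Gr ℂ d (d - k)),
          S ⊂ Λ ∧ IsTopologicalSphere (2 * (d - k) - 1) S) := by
  constructor
  · rintro ⟨Λ, hΛ, S, hS, hsphere⟩
    exact false_of_transverse_sphere hd (by rw [Module.finrank_self]; omega) hΛ hS hsphere
  · rintro ⟨Λ, hΛ, S, hS, hsphere⟩
    exact false_of_transverse_sphere hd (by rw [Complex.finrank_real_complex]; omega) hΛ hS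
      hsphere
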